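/- Let $\mathbb{K}$ be a field. A $\mathbb{K}$-algebra is a $\mathbb{K}$-vector space with a bilinear multiplication (not necessarily associative or unital); morphisms are the linear maps that preserve the multiplication. A variety of $\mathbb{K}$-algebras is the class of all $\mathbb{K}$-algebras satisfying a given set of identities $\varphi=0$, where each $\varphi$ is a non-associative polynomial, i.e. an element of the free $\mathbb{K}$-algebra on a set of variables. It is called operadic if it is determined by some set of multilinear polynomials, where $\varphi$ is multilinear if there is a finite set of variables such that every monomial of $\varphi$ contains each variable of this set exactly once and no other variable. We view a variety as a full subcategory of the category of $\mathbb{K}$-algebras. In a pointed category with finite sums, finite products and kernels, let $X\diamond Y$ be the kernel of the canonical morphism $$\begin{pmatrix}1_X&0\\0&1_Y\end{pmatrix}\colon X+Y\to X\times Y,$$ and let $X\diamond Y\diamond Z$ be the kernel of the canonical morphism $$X+Y+Z\to (X+Y)\times(X+Z)\times(Y+Z)$$ whose three components are the identity on the two summands that occur in their codomain and zero on the third. The category is cosmash associative if for all objects $X$, $Y$, $Z$ the two canonical comparison morphisms $X\diamond(Y\diamond Z)\to X\diamond Y\diamond Z$ and $(X\diamond Y)\diamond Z\to X\diamond Y\diamond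 Z$, induced by the inclusions $Y\diamond Z\to Y+Z$ and $X\diamond Y\to X+Y$ respectively, are isomorphisms. Let $\mathsf{CA}_{\mathbb{K}}$, $\mathsf{Ab}_{\mathbb{K}}$ and $\mathsf{Triv}_{\mathbb{K}}$ be the varieties of commutative associative $\mathbb{K}$-algebras, of abelian $\mathbb{K}$-algebras (those with $xy=0$) and of trivial $\mathbb{K}$-algebras (those with $x=0$). **Proposition.** Let $\mathcal{V}$ be an operadic variety of $\mathbb{K}$-algebras that is cosmash associative. If $\mathcal{V}$ is a proper subvariety of $\mathsf{CA}_{\mathbb{K}}$, then $\mathcal{V}=\mathsf{Ab}_{\mathbb{K}}$ or $\mathcal{V}=\mathsf{Triv}_{\mathbb{K}}$. -/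

import Mathlib

open CategoryTheory CategoryTheory.Limits

universe v u

/-! ## Cosmash products in pointed categories with finite sums, finite products and kernels

A category with zero morphisms and finite products has a zero object (its terminal object), so the
instance arguments below describe pointed categories with finite sums, finite products and
kernels. -/

section Cosmash

noncomputable section

variable {C : Type u} [Category.{v} C] [HasZeroMorphisms C] [HasFiniteCoproducts C]
  [HasFiniteProducts C] [HasKernels C]

/-- The canonical morphism `X + Y ⟶ X × Y` with matrix the identity matrix. -/
def sigmaTwo (X Y : C) : X ⨿ Y ⟶ X ⨯ Y :=
  prod.lift (coprod.desc (𝟙 X) 0) (coprod.desc 0 (𝟙 Y))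

/-- The binary cosmash product `X ⋄ Y`: the kernel of `X + Y ⟶ X × Y`. -/
abbrev cosmashTwo (X Y : C) : C := kernel (sigmaTwo X Y)

/-- The canonical inclusion `X ⋄ Y ⟶ X + Y`. -/
def cosmashTwoι (X Y : C) : cosmashTwo X Y ⟶ X ⨿ Y := kernel.ι (sigmaTwo X Y)

/-- The canonical morphism `X + Y + Z ⟶ (X + Y) × (X + Z) × (Y + Z)`, whose three components
send the summand `Z`, respectively `Y`, respectively `X` to zero. -/
def sigmaThree (X Y Z : C) : X ⨿ (Y ⨿ Z) ⟶ (X ⨿ Y) ⨯ ((X ⨿ Z) ⨯ (Y ⨿ Z)) :=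
  prod.lift (coprod.desc coprod.inl (coprod.desc coprod.inr 0))
    (prod.lift (coprod.desc coprod.inl (coprod.desc 0 coprod.inr))
      (coprod.desc 0 (coprod.desc coprod.inl coprod.inr)))

/-- The ternary cosmash product `X ⋄ Y ⋄ Z`. -/
abbrev cosmashThree (X Y Z : C) : C := kernel (sigmaThree X Y Z)

/-- The canonical inclusion `X ⋄ Y ⋄ Z ⟶ X + Y + Z`. -/
def cosmashThreeι (X Y Z : C) : cosmashThree X Y Z ⟶ X ⨿ (Y ⨿ Z) := kernel.ι (sigmaThree X Y Z)

theorem cosmashTwo_condition (X Y : C) : cosmashTwoι X Y ≫ sigmaTwo X Y = 0 :=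
  kernel.condition _

theorem cosmashTwoι_desc_left (X Y : C) :
    cosmashTwoι X Y ≫ coprod.desc (𝟙 X) 0 = 0 := by
  have h : (cosmashTwoι X Y ≫ sigmaTwo X Y) ≫ prod.fst = 0 := by
    rw [cosmashTwo_condition, zero_comp]
  rwa [Category.assoc, sigmaTwo, prod.lift_fst] at h

theorem cosmashTwoι_desc_right (X Y : C) :
    cosmashTwoι X Y ≫ coprod.desc 0 (𝟙 Y) = 0 := by
  have h : (cosmashTwoι X Y ≫ sigmaTwo X Y) ≫ prod.snd = 0 := by
    rw [cosmashTwo_condition, zero_comp]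
  rwa [Category.assoc, sigmaTwo, prod.lift_snd] at h

theorem cosmashTwoι_comp_left {X Y W : C} (f : X ⟶ W) :
    cosmashTwoι X Y ≫ coprod.desc f 0 = 0 := by
  have h : coprod.desc f (0 : Y ⟶ W) = coprod.desc (𝟙 X) 0 ≫ f := by
    ext <;> simp [coprod.inl_desc, coprod.inr_desc]
  rw [h, ← Category.assoc, cosmashTwoι_desc_left, zero_comp]

theorem cosmashTwoι_comp_right {X Y W : C} (f : Y ⟶ W) :
    cosmashTwoι X Y ≫ coprod.desc 0 f = 0 := by
  have h : coprod.desc (0 : X ⟶ W) f = coprod.desc 0 (𝟙 Y) ≫ f := by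
    ext <;> simp [coprod.inl_desc, coprod.inr_desc]
  rw [h, ← Category.assoc, cosmashTwoι_desc_right, zero_comp]

theorem comparisonRight_condition (X Y Z : C) :
    (cosmashTwoι X (cosmashTwo Y Z) ≫ coprod.map (𝟙 X) (cosmashTwoι Y Z)) ≫ sigmaThree X Y Z
      = 0 := by
  have h1 : cosmashTwoι Y Z ≫ coprod.desc coprod.inl coprod.inr = cosmashTwoι Y Z := by simp
  rw [Category.assoc, sigmaThree, prod.comp_lift, prod.comp_lift, prod.comp_lift, prod.comp_lift]
  simp only [coprod.map_desc, Category.id_comp, cosmashTwoι_comp_left, cosmashTwoι_comp_right, h1,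
    comp_zero]
  ext <;> simp [prod.lift_fst, prod.lift_snd]

/-- The canonical comparison morphism `X ⋄ (Y ⋄ Z) ⟶ X ⋄ Y ⋄ Z` induced by
`1 + ι : X + (Y ⋄ Z) ⟶ X + (Y + Z)`. -/
def comparisonRight (X Y Z : C) : cosmashTwo X (cosmashTwo Y Z) ⟶ cosmashThree X Y Z :=
  kernel.lift (sigmaThree X Y Z)
    (cosmashTwoι X (cosmashTwo Y Z) ≫ coprod.map (𝟙 X) (cosmashTwoι Y Z))
    (comparisonRight_condition X Y Z)

theorem comparisonLeft_condition (X Y Z : C) :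
    (cosmashTwoι (cosmashTwo X Y) Z ≫ coprod.map (cosmashTwoι X Y) (𝟙 Z) ≫
      (coprod.associator X Y Z).hom) ≫ sigmaThree X Y Z = 0 := by
  have e1 : (coprod.associator X Y Z).hom ≫ coprod.desc coprod.inl (coprod.desc coprod.inr 0)
      = coprod.desc (𝟙 (X ⨿ Y)) 0 := by
    ext <;> simp [coprod.associator, coprod.inl_desc, coprod.inr_desc]
  have e2 : (coprod.associator X Y Z).hom ≫
      coprod.desc (coprod.inl : X ⟶ X ⨿ Z) (coprod.desc 0 coprod.inr)
      = coprod.desc (coprod.desc coprod.inl 0) coprod.inr := by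
    ext <;> simp [coprod.associator, coprod.inl_desc, coprod.inr_desc]
  have e3 : (coprod.associator X Y Z).hom ≫
      coprod.desc 0 (coprod.desc (coprod.inl : Y ⟶ Y ⨿ Z) coprod.inr)
      = coprod.desc (coprod.desc 0 coprod.inl) coprod.inr := by
    ext <;> simp [coprod.associator, coprod.inl_desc, coprod.inr_desc]
  simp only [Category.assoc, sigmaThree, prod.comp_lift, e1, e2, e3]
  simp only [coprod.map_desc, Category.comp_id, Category.id_comp, cosmashTwoι_comp_left,
    cosmashTwoι_comp_right]
  ext <;> simp [prod.lift_fst, prod.lift_snd]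

/-- The canonical comparison morphism `(X ⋄ Y) ⋄ Z ⟶ X ⋄ Y ⋄ Z` induced by
`ι + 1 : (X ⋄ Y) + Z ⟶ (X + Y) + Z`. -/
def comparisonLeft (X Y Z : C) : cosmashTwo (cosmashTwo X Y) Z ⟶ cosmashThree X Y Z :=
  kernel.lift (sigmaThree X Y Z)
    (cosmashTwoι (cosmashTwo X Y) Z ≫ coprod.map (cosmashTwoι X Y) (𝟙 Z) ≫
      (coprod.associator X Y Z).hom)
    (comparisonLeft_condition X Y Z)

variable (C) in
/-- A category is cosmash associative when both canonical comparison morphisms are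
isomorphisms, for all triples of objects. -/
def CosmashAssociative : Prop :=
  ∀ X Y Z : C, IsIso (comparisonRight X Y Z) ∧ IsIso (comparisonLeft X Y Z)

end

end Cosmash

/-! ## Non-associative algebras and their varieties -/

/-- A (non-unital, not necessarily associative) `K`-algebra: a vector space with a bilinear
multiplication. -/
structure NAAlg (K : Type u) [Field K] where
  /-- The underlying type. -/
  carrier : Type u
  [ring : NonUnitalNonAssocRing carrier]
  [module : Module K carrier]
  [isScalarTower : IsScalarTower K carrier carrier]
  [smulCommClass : SMulCommClass K carrier carrier]

namespace NAAlg

variable (K : Type u) [Field K]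

attribute [instance] NAAlg.ring NAAlg.module NAAlg.isScalarTower NAAlg.smulCommClass

instance : CoeSort (NAAlg K) (Type u) := ⟨NAAlg.carrier⟩

/-- Morphisms are the `K`-linear maps that preserve the multiplication. -/
instance : Category.{u} (NAAlg K) where
  Hom A B := A →ₙₐ[K] B
  id A := NonUnitalAlgHom.id K A
  comp f g := NonUnitalAlgHom.comp g f

end NAAlg

/-- The multiset of letters (counted with multiplicity) of a non-associative word. -/
def FreeMagma.letters {X : Type u} : FreeMagma X → Multiset X
  | .of x => {x}
  | .mul a b => a.letters + b.letters

/-- A non-associative polynomial is multilinear if there is a finite set `s` of variables such that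
each of its monomials contains every variable in `s` exactly once, and no other variable. -/
def IsMultilinearPoly {K : Type u} [Field K] {X : Type u}
    (φ : FreeNonUnitalNonAssocAlgebra K X) : Prop :=
  ∃ s : Finset X, ∀ w ∈ φ.coeff.support, FreeMagma.letters w = s.val

/-- The algebra `A` satisfies the identity `φ`: every substitution of elements of `A` for
the variables of `φ` gives zero. -/
def SatisfiesIdentity {K : Type u} [Field K] {X : Type u} (A : NAAlg K)
    (φ : FreeNonUnitalNonAssocAlgebra K X) : Prop :=
  ∀ a : X → A, FreeNonUnitalNonAssocAlgebra.lift K a φ = 0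

/-- The class of all `K`-algebras that satisfy all identities in `I`. -/
def algebrasSatisfying {K : Type u} [Field K] {X : Type u}
    (I : Set (FreeNonUnitalNonAssocAlgebra K X)) : ObjectProperty (NAAlg K) :=
  fun A => ∀ φ ∈ I, SatisfiesIdentity A φ

/-- A variety of `K`-algebras: a class of algebras determined by a set of identities. -/
@[ext]
structure AlgVariety (K : Type u) [Field K] where
  /-- The class of the algebras in the variety. -/
  mem : ObjectProperty (NAAlg K)
  exists_identities : ∃ (X : Type u) (I : Set (FreeNonUnitalNonAssocAlgebra K X)),
    mem = algebrasSatisfying I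

namespace AlgVariety

variable {K : Type u} [Field K]

/-- A variety is operadic if it is determined by some set of multilinear polynomials. -/
def IsOperadic (V : AlgVariety K) : Prop :=
  ∃ (X : Type u) (I : Set (FreeNonUnitalNonAssocAlgebra K X)),
    (∀ φ ∈ I, IsMultilinearPoly φ) ∧ V.mem = algebrasSatisfying I

/-- `V` is a proper subvariety of `W`. -/
def IsProperSubvariety (V W : AlgVariety K) : Prop :=
  (∀ A : NAAlg K, V.mem A → W.mem A) ∧ V ≠ W

/-- A variety, as a full subcategory of the category of all `K`-algebras. -/
abbrev Cat (V : AlgVariety K) : Type (u + 1) := V.mem.FullSubcategory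

/-- A morphism in a variety as a homomorphism of algebras. -/
def toHom {V : AlgVariety K} {A B : V.Cat} (f : A ⟶ B) : A.obj →ₙₐ[K] B.obj := f.hom

/-- A homomorphism of algebras as a morphism in a variety. -/
def ofHom {V : AlgVariety K} {A B : V.Cat} (f : A.obj →ₙₐ[K] B.obj) : A ⟶ B :=
  ObjectProperty.homMk f

theorem hom_ext {V : AlgVariety K} {A B : V.Cat} {f g : A ⟶ B}
    (h : ∀ a, toHom f a = toHom g a) : f = g :=
  ObjectProperty.hom_ext _ (NonUnitalAlgHom.ext h)

@[simp] theorem toHom_ofHom {V : AlgVariety K} {A B : V.Cat} (f : A.obj →ₙₐ[K] B.obj) :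
    toHom (ofHom f) = f := rfl

@[simp] theorem toHom_comp {V : AlgVariety K} {A B C : V.Cat} (f : A ⟶ B) (g : B ⟶ C) :
    toHom (f ≫ g) = (toHom g).comp (toHom f) := rfl

@[simp] theorem toHom_id {V : AlgVariety K} (A : V.Cat) :
    toHom (𝟙 A) = NonUnitalAlgHom.id K A.obj := rfl

theorem lift_comp_apply {X : Type u} {A B : NAAlg K} (g : A →ₙₐ[K] B) (a : X → A)
    (φ : FreeNonUnitalNonAssocAlgebra K X) :
    g (FreeNonUnitalNonAssocAlgebra.lift K a φ)
      = FreeNonUnitalNonAssocAlgebra.lift K (fun x => g (a x)) φ := by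
  have h : g.comp (FreeNonUnitalNonAssocAlgebra.lift K a)
      = FreeNonUnitalNonAssocAlgebra.lift K (fun x => g (a x)) := by
    refine FreeNonUnitalNonAssocAlgebra.hom_ext K fun x => ?_
    rw [NonUnitalAlgHom.comp_apply, FreeNonUnitalNonAssocAlgebra.lift_of_apply,
      FreeNonUnitalNonAssocAlgebra.lift_of_apply]
  exact DFunLike.congr_fun h φ

/-- An algebra whose elements are separated by homomorphisms to algebras in `V` lies in `V`. -/
theorem mem_of_separated (V : AlgVariety K) (A : NAAlg K)
    (h : ∀ a : A, (∀ B : NAAlg K, V.mem B → ∀ g : A →ₙₐ[K] B, g a = 0) → a = 0) : V.mem A := by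
  obtain ⟨X, I, hI⟩ := V.exists_identities
  rw [hI]
  intro φ hφ a
  refine h _ fun B hB g => ?_
  rw [lift_comp_apply]
  rw [hI] at hB
  exact hB φ hφ _

section Limits

variable (V : AlgVariety K)

noncomputable section

instance : HasZeroMorphisms V.Cat where
  zero A B := ⟨ofHom (0 : A.obj →ₙₐ[K] B.obj)⟩
  comp_zero {_ _} _ _ := rfl
  zero_comp _ {_ _} f := hom_ext fun _ => map_zero (toHom f)

theorem toHom_zero {A B : V.Cat} : toHom (0 : A ⟶ B) = 0 := rfl

/-- The one-element algebra, as an object of `V`. -/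
def trivialObj : V.Cat :=
  ⟨{ carrier := PUnit.{u + 1} }, V.mem_of_separated _ fun _ _ => rfl⟩

instance : HasTerminal V.Cat := by
  have : ∀ A : V.Cat, Unique (A ⟶ V.trivialObj) := fun A =>
    { default := 0
      uniq := fun f => hom_ext fun _ => rfl }
  exact hasTerminal_of_unique V.trivialObj

instance : HasInitial V.Cat := by
  have : ∀ A : V.Cat, Unique (V.trivialObj ⟶ A) := fun A =>
    { default := 0
      uniq := fun f => hom_ext fun a => by
        have h : a = 0 := rfl
        rw [h, map_zero, map_zero] }
  exact hasInitial_of_unique V.trivialObj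

/-- The product of two algebras in `V`. -/
def prodObj (A B : V.Cat) : V.Cat :=
  ⟨{ carrier := A.obj × B.obj }, V.mem_of_separated _ fun _ h =>
    Prod.ext (h A.obj A.property (NonUnitalAlgHom.fst K A.obj B.obj))
      (h B.obj B.property (NonUnitalAlgHom.snd K A.obj B.obj))⟩

instance : HasBinaryProducts V.Cat := by
  have : ∀ A B : V.Cat, HasLimit (pair A B) := fun A B => ⟨⟨{
    cone := BinaryFan.mk (P := V.prodObj A B)
      (ofHom (NonUnitalAlgHom.fst K A.obj B.obj)) (ofHom (NonUnitalAlgHom.snd K A.obj B.obj))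
    isLimit := BinaryFan.isLimitMk
      (fun s => ofHom (B := V.prodObj A B) (NonUnitalAlgHom.prod (toHom s.fst) (toHom s.snd)))
      (fun s => hom_ext fun _ => rfl)
      (fun s => hom_ext fun _ => rfl)
      (fun s m h1 h2 => by
        refine hom_ext fun a => Prod.ext ?_ ?_
        · exact DFunLike.congr_fun (congrArg toHom h1) a
        · exact DFunLike.congr_fun (congrArg toHom h2) a) }⟩⟩
  exact hasBinaryProducts_of_hasLimit_pair _

instance : HasFiniteProducts V.Cat := hasFiniteProducts_of_has_binary_and_terminal

/-- The kernel of a homomorphism of algebras in `V`. -/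
def kerObj {A B : V.Cat} (f : A ⟶ B) : V.Cat :=
  ⟨{ carrier := NonUnitalAlgHom.equalizer (toHom f) (0 : A.obj →ₙₐ[K] B.obj) },
    V.mem_of_separated _ fun _ h => Subtype.ext (h A.obj A.property
      (NonUnitalSubalgebraClass.subtype
        (NonUnitalAlgHom.equalizer (toHom f) (0 : A.obj →ₙₐ[K] B.obj))))⟩

instance : HasKernels V.Cat where
  has_limit {A B} f := ⟨⟨{
    cone := KernelFork.ofι (Z := V.kerObj f) (ofHom (NonUnitalSubalgebraClass.subtype
        (NonUnitalAlgHom.equalizer (toHom f) (0 : A.obj →ₙₐ[K] B.obj))))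
        (hom_ext fun a => a.2)
    isLimit := KernelFork.IsLimit.ofι _ _
      (fun g hg => ofHom (B := V.kerObj f) (NonUnitalAlgHom.codRestrict (toHom g)
        (NonUnitalAlgHom.equalizer (toHom f) (0 : A.obj →ₙₐ[K] B.obj))
        fun a => DFunLike.congr_fun (congrArg toHom hg) a))
      (fun _ _ => hom_ext fun _ => rfl)
      (fun _ _ _ hm => hom_ext fun a => Subtype.ext
        (DFunLike.congr_fun (congrArg toHom hm) a)) }⟩⟩

section Coproduct

variable (A B : V.Cat)

/-- The polynomials with variables in `A` and `B` that vanish in all algebras of `V` that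
receive homomorphisms from `A` and `B`. -/
def coprodRel : Submodule K (FreeNonUnitalNonAssocAlgebra K (A.obj ⊕ B.obj)) where
  carrier := {p | ∀ (C : NAAlg K), V.mem C → ∀ (f : A.obj →ₙₐ[K] C) (g : B.obj →ₙₐ[K] C),
    FreeNonUnitalNonAssocAlgebra.lift K (Sum.elim f g) p = 0}
  add_mem' hp hq C hC f g := by rw [map_add, hp C hC f g, hq C hC f g, add_zero]
  zero_mem' C hC f g := map_zero _
  smul_mem' c p hp C hC f g := by rw [map_smul, hp C hC f g, smul_zero]

theorem mem_coprodRel {p : FreeNonUnitalNonAssocAlgebra K (A.obj ⊕ B.obj)} :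
    p ∈ V.coprodRel A B ↔ ∀ (C : NAAlg K), V.mem C → ∀ (f : A.obj →ₙₐ[K] C)
      (g : B.obj →ₙₐ[K] C), FreeNonUnitalNonAssocAlgebra.lift K (Sum.elim f g) p = 0 := Iff.rfl

/-- The underlying vector space of the coproduct: polynomials with variables in `A` and `B`, modulo
the identities of `V` and those of `A` and `B`. -/
abbrev CoprodCarrier : Type u :=
  FreeNonUnitalNonAssocAlgebra K (A.obj ⊕ B.obj) ⧸ V.coprodRel A B

instance : Mul (V.CoprodCarrier A B) where
  mul := Quotient.map₂ (· * ·) (by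
    intro p p' hp q q' hq
    replace hp := (Submodule.quotientRel_def _).1 hp
    replace hq := (Submodule.quotientRel_def _).1 hq
    refine (Submodule.quotientRel_def _).2 ?_
    rw [mem_coprodRel] at hp hq ⊢
    intro C hC f g
    have h1 := hp C hC f g
    have h2 := hq C hC f g
    rw [map_sub, sub_eq_zero] at h1 h2 ⊢
    rw [map_mul, map_mul, h1, h2])

theorem mk_mul_mk (p q : FreeNonUnitalNonAssocAlgebra K (A.obj ⊕ B.obj)) :
    (Submodule.Quotient.mk p : V.CoprodCarrier A B) * Submodule.Quotient.mk q
      = Submodule.Quotient.mk (p * q) := rfl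

instance : NonUnitalNonAssocRing (V.CoprodCarrier A B) where
  left_distrib a b c := by
    obtain ⟨a, rfl⟩ := Submodule.Quotient.mk_surjective _ a
    obtain ⟨b, rfl⟩ := Submodule.Quotient.mk_surjective _ b
    obtain ⟨c, rfl⟩ := Submodule.Quotient.mk_surjective _ c
    simp only [← Submodule.Quotient.mk_add, mk_mul_mk, mul_add]
  right_distrib a b c := by
    obtain ⟨a, rfl⟩ := Submodule.Quotient.mk_surjective _ a
    obtain ⟨b, rfl⟩ := Submodule.Quotient.mk_surjective _ b
    obtain ⟨c, rfl⟩ := Submodule.Quotient.mk_surjective _ c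
    simp only [← Submodule.Quotient.mk_add, mk_mul_mk, add_mul]
  zero_mul a := by
    obtain ⟨a, rfl⟩ := Submodule.Quotient.mk_surjective _ a
    rw [← Submodule.Quotient.mk_zero, mk_mul_mk, zero_mul]
  mul_zero a := by
    obtain ⟨a, rfl⟩ := Submodule.Quotient.mk_surjective _ a
    rw [← Submodule.Quotient.mk_zero, mk_mul_mk, mul_zero]

instance : IsScalarTower K (V.CoprodCarrier A B) (V.CoprodCarrier A B) where
  smul_assoc c a b := by
    obtain ⟨a, rfl⟩ := Submodule.Quotient.mk_surjective _ a
    obtain ⟨b, rfl⟩ := Submodule.Quotient.mk_surjective _ b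
    simp only [smul_eq_mul, ← Submodule.Quotient.mk_smul, mk_mul_mk, smul_mul_assoc]

instance : SMulCommClass K (V.CoprodCarrier A B) (V.CoprodCarrier A B) where
  smul_comm c a b := by
    obtain ⟨a, rfl⟩ := Submodule.Quotient.mk_surjective _ a
    obtain ⟨b, rfl⟩ := Submodule.Quotient.mk_surjective _ b
    simp only [smul_eq_mul, ← Submodule.Quotient.mk_smul, mk_mul_mk, mul_smul_comm]

variable {A B} in
/-- The homomorphism out of the coproduct induced by two homomorphisms. -/
def coprodDesc {C : NAAlg K} (hC : V.mem C) (f : A.obj →ₙₐ[K] C) (g : B.obj →ₙₐ[K] C) :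
    V.CoprodCarrier A B →ₙₐ[K] C where
  toFun := (V.coprodRel A B).liftQ
    (FreeNonUnitalNonAssocAlgebra.lift K (Sum.elim f g) :
      FreeNonUnitalNonAssocAlgebra K (A.obj ⊕ B.obj) →ₗ[K] C) (fun _ hp => hp C hC f g)
  map_smul' c a := map_smul _ c a
  map_zero' := map_zero _
  map_add' a b := map_add _ a b
  map_mul' a b := by
    obtain ⟨a, rfl⟩ := Submodule.Quotient.mk_surjective _ a
    obtain ⟨b, rfl⟩ := Submodule.Quotient.mk_surjective _ b
    rw [mk_mul_mk]
    exact map_mul (FreeNonUnitalNonAssocAlgebra.lift K (Sum.elim f g)) a b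

theorem coprodDesc_mk {C : NAAlg K} (hC : V.mem C) (f : A.obj →ₙₐ[K] C) (g : B.obj →ₙₐ[K] C)
    (p : FreeNonUnitalNonAssocAlgebra K (A.obj ⊕ B.obj)) :
    V.coprodDesc hC f g (Submodule.Quotient.mk p)
      = FreeNonUnitalNonAssocAlgebra.lift K (Sum.elim f g) p := rfl

/-- The coproduct of two algebras in `V`. -/
def coprodObj : V.Cat :=
  ⟨{ carrier := V.CoprodCarrier A B }, V.mem_of_separated _ fun a h => by
    obtain ⟨a, rfl⟩ := Submodule.Quotient.mk_surjective _ a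
    rw [Submodule.Quotient.mk_eq_zero]
    exact fun C hC f g => h C hC (V.coprodDesc hC f g)⟩

theorem mk_eq_mk {p q : FreeNonUnitalNonAssocAlgebra K (A.obj ⊕ B.obj)}
    (h : ∀ (C : NAAlg K), V.mem C → ∀ (f : A.obj →ₙₐ[K] C) (g : B.obj →ₙₐ[K] C),
      FreeNonUnitalNonAssocAlgebra.lift K (Sum.elim f g) p
        = FreeNonUnitalNonAssocAlgebra.lift K (Sum.elim f g) q) :
    (Submodule.Quotient.mk p : V.CoprodCarrier A B) = Submodule.Quotient.mk q := by
  rw [Submodule.Quotient.eq]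
  intro C hC f g
  rw [map_sub, h C hC f g, sub_self]

/-- The first coproduct inclusion. -/
def coprodInl : A.obj →ₙₐ[K] V.CoprodCarrier A B where
  toFun a := Submodule.Quotient.mk (FreeNonUnitalNonAssocAlgebra.of K (Sum.inl a))
  map_smul' c a := by
    change _ = c • _
    rw [← Submodule.Quotient.mk_smul]
    exact V.mk_eq_mk A B fun C hC f g => by simp
  map_zero' := by
    rw [← Submodule.Quotient.mk_zero]
    exact V.mk_eq_mk A B fun C hC f g => by simp
  map_add' a b := by
    rw [← Submodule.Quotient.mk_add]
    exact V.mk_eq_mk A B fun C hC f g => by simp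
  map_mul' a b := by
    rw [mk_mul_mk]
    exact V.mk_eq_mk A B fun C hC f g => by simp

/-- The second coproduct inclusion. -/
def coprodInr : B.obj →ₙₐ[K] V.CoprodCarrier A B where
  toFun b := Submodule.Quotient.mk (FreeNonUnitalNonAssocAlgebra.of K (Sum.inr b))
  map_smul' c a := by
    change _ = c • _
    rw [← Submodule.Quotient.mk_smul]
    exact V.mk_eq_mk A B fun C hC f g => by simp
  map_zero' := by
    rw [← Submodule.Quotient.mk_zero]
    exact V.mk_eq_mk A B fun C hC f g => by simp
  map_add' a b := by
    rw [← Submodule.Quotient.mk_add]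
    exact V.mk_eq_mk A B fun C hC f g => by simp
  map_mul' a b := by
    rw [mk_mul_mk]
    exact V.mk_eq_mk A B fun C hC f g => by simp

variable {A B} in
theorem coprod_hom_ext {C : NAAlg K} {m m' : V.CoprodCarrier A B →ₙₐ[K] C}
    (h1 : ∀ a, m (V.coprodInl A B a) = m' (V.coprodInl A B a))
    (h2 : ∀ b, m (V.coprodInr A B b) = m' (V.coprodInr A B b)) : m = m' := by
  let π : FreeNonUnitalNonAssocAlgebra K (A.obj ⊕ B.obj) →ₙₐ[K] V.CoprodCarrier A B :=
    { toFun := Submodule.Quotient.mk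
      map_smul' := fun _ _ => rfl
      map_zero' := rfl
      map_add' := fun _ _ => rfl
      map_mul' := fun _ _ => rfl }
  have h : m.comp π = m'.comp π := by
    ext (a | b)
    · exact h1 a
    · exact h2 b
  ext a
  obtain ⟨a, rfl⟩ := Submodule.Quotient.mk_surjective _ a
  exact DFunLike.congr_fun h a

end Coproduct

instance : HasBinaryCoproducts V.Cat := by
  have : ∀ A B : V.Cat, HasColimit (pair A B) := fun A B => ⟨⟨{
    cocone := BinaryCofan.mk (P := V.coprodObj A B)
      (ofHom (B := V.coprodObj A B) (V.coprodInl A B))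
      (ofHom (B := V.coprodObj A B) (V.coprodInr A B))
    isColimit := BinaryCofan.isColimitMk
      (fun s => ofHom (A := V.coprodObj A B)
        (V.coprodDesc s.pt.property (toHom s.inl) (toHom s.inr)))
      (fun s => hom_ext fun a =>
        FreeNonUnitalNonAssocAlgebra.lift_of_apply K (Sum.elim (toHom s.inl) (toHom s.inr))
          (Sum.inl a))
      (fun s => hom_ext fun b =>
        FreeNonUnitalNonAssocAlgebra.lift_of_apply K (Sum.elim (toHom s.inl) (toHom s.inr))
          (Sum.inr b))
      (fun s m h1 h2 => ObjectProperty.hom_ext _ (V.coprod_hom_ext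
        (fun a => (DFunLike.congr_fun (congrArg toHom h1) a).trans
          (FreeNonUnitalNonAssocAlgebra.lift_of_apply K
            (Sum.elim (toHom s.inl) (toHom s.inr)) (Sum.inl a)).symm)
        (fun b => (DFunLike.congr_fun (congrArg toHom h2) b).trans
          (FreeNonUnitalNonAssocAlgebra.lift_of_apply K
            (Sum.elim (toHom s.inl) (toHom s.inr)) (Sum.inr b)).symm))) }⟩⟩
  exact hasBinaryCoproducts_of_hasColimit_pair _

instance : HasFiniteCoproducts V.Cat := hasFiniteCoproducts_of_has_binary_and_initial

end

end Limits

/-! ### The varieties of commutative associative, abelian, and trivial algebras -/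

section Examples

variable (K)

/-- The variety of commutative associative algebras. -/
def CA : AlgVariety K where
  mem A := (∀ a b c : A, a * (b * c) = a * b * c) ∧ ∀ a b : A, a * b = b * a
  exists_identities := by
    let x : ULift.{u} (Fin 3) → FreeNonUnitalNonAssocAlgebra K (ULift.{u} (Fin 3)) :=
      FreeNonUnitalNonAssocAlgebra.of K
    refine ⟨ULift.{u} (Fin 3), {x ⟨0⟩ * (x ⟨1⟩ * x ⟨2⟩) - x ⟨0⟩ * x ⟨1⟩ * x ⟨2⟩,
      x ⟨0⟩ * x ⟨1⟩ - x ⟨1⟩ * x ⟨0⟩}, ?_⟩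
    funext A
    simp only [algebrasSatisfying, SatisfiesIdentity, Set.mem_insert_iff, Set.mem_singleton_iff,
      forall_eq_or_imp, forall_eq, map_sub, map_mul, x,
      FreeNonUnitalNonAssocAlgebra.lift_of_apply, sub_eq_zero, eq_iff_iff]
    constructor
    · exact fun h => ⟨fun a => h.1 _ _ _, fun a => h.2 _ _⟩
    · exact fun h => ⟨fun a b c => h.1 (fun i => ![a, b, c] i.down),
        fun a b => h.2 (fun i => ![a, b, b] i.down)⟩

/-- The variety of abelian algebras, that is, of those with zero multiplication. -/
def Ab : AlgVariety K where
  mem A := ∀ a b : A, a * b = 0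
  exists_identities := by
    let x : ULift.{u} (Fin 2) → FreeNonUnitalNonAssocAlgebra K (ULift.{u} (Fin 2)) :=
      FreeNonUnitalNonAssocAlgebra.of K
    refine ⟨ULift.{u} (Fin 2), {x ⟨0⟩ * x ⟨1⟩}, ?_⟩
    funext A
    simp only [algebrasSatisfying, SatisfiesIdentity, Set.mem_singleton_iff,
      forall_eq, map_mul, x, FreeNonUnitalNonAssocAlgebra.lift_of_apply, eq_iff_iff]
    exact ⟨fun h a => h _ _, fun h a b => h (fun i => ![a, b] i.down)⟩

/-- The variety of trivial (that is, one-element) algebras. -/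
def Triv : AlgVariety K where
  mem A := ∀ a : A, a = 0
  exists_identities := by
    refine ⟨PUnit.{u + 1}, {FreeNonUnitalNonAssocAlgebra.of K PUnit.unit}, ?_⟩
    funext A
    simp only [algebrasSatisfying, SatisfiesIdentity, Set.mem_singleton_iff,
      forall_eq, FreeNonUnitalNonAssocAlgebra.lift_of_apply, eq_iff_iff]
    exact ⟨fun h a => h _, fun h a => h fun _ => a⟩

end Examples

end AlgVariety

/-! In a commutative associative algebra all monomials of a multilinear polynomial take the same
value, so the polynomial reduces to the sum of its coefficients times one product of distinct
variables. A proper operadic subvariety of `CA K` therefore has a defining identity with nonzero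
coefficient sum. If `n` is the least degree of such an identity, the variety consists of the
commutative associative algebras in which products of `n` elements vanish
(`exists_nilpotency_index`). The cases `n = 1` and `n = 2` give `Triv K` and `Ab K`.

For `n = k + 3` cosmash associativity fails. Let `F` be the line with zero multiplication, with
generators `y` and `z` in the two summands of `F + F`, and let `A` be the ideal `(x, e)` of `K[x,
e]/(x ^ (k + 2), e ^ 2)`. In `A + F + F` the element `x ^ (k + 1) * (y * z)` is a product of `k + 3`
elements, hence zero. In `A + (F ⋄ F)`, however, `y * z` comes from a single element `t` of `F ⋄ F`,
and some homomorphism `F ⋄ F ⟶ A` sends `t` to `e` (`exists_hom_cosmashTwo`). Thus `x ^ (k + 1) * t`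
has the nonzero image `x ^ (k + 1) * e`, and the right comparison morphism is not monic
(`mul_eq_zero_of_cosmashAssociative`).

Kernels and coproducts are used only through their universal properties. Morphisms out of `F` are
the elements of square zero, so `F` tests monomorphisms and produces elements of kernels; all
elements treated in this way have square zero. -/

/-! ### Multilinear polynomials in commutative associative algebras -/

theorem FreeMagma.letters_mul {X : Type u} (a b : FreeMagma X) :
    (a * b).letters = a.letters + b.letters := rfl

theorem FreeMagma.card_letters_pos {X : Type u} (w : FreeMagma X) : 0 < w.letters.card := by
  induction w with
  | ih1 x => simp [FreeMagma.letters]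
  | ih2 a b ha hb => rw [FreeMagma.letters_mul, Multiset.card_add]; omega

/-- The target of `f` is commutative and associative, so bracketing and order of the word are
forgotten and only its letters matter. -/
theorem FreeMagma.map_lift_eq_prod {X A R : Type*} [Mul A] [CommMonoid R] (f : A →ₙ* R)
    (a : X → A) (w : FreeMagma X) :
    f (FreeMagma.lift a w) = (w.letters.map fun x => f (a x)).prod := by
  induction w with
  | ih1 x => simp [FreeMagma.letters]
  | ih2 p q hp hq =>
    simp only [FreeMagma.letters_mul, Multiset.map_add, Multiset.prod_add, ← hp, ← hq]
    exact (congrArg f (map_mul (FreeMagma.lift a) p q)).trans (map_mul f _ _)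

theorem FreeNonUnitalNonAssocAlgebra.lift_eq_sum {K X A : Type*} [CommSemiring K]
    [NonUnitalNonAssocSemiring A] [Module K A] [IsScalarTower K A A] [SMulCommClass K A A]
    (a : X → A) (φ : FreeNonUnitalNonAssocAlgebra K X) :
    FreeNonUnitalNonAssocAlgebra.lift K a φ = φ.coeff.sum fun w c => c • FreeMagma.lift a w :=
  rfl

/-- All monomials have the same letters, hence the same image in `R`, which factors out of the sum.
-/
theorem FreeNonUnitalNonAssocAlgebra.map_lift_multilinear {K X A R : Type*} [CommSemiring K]
    [NonUnitalNonAssocSemiring A] [Module K A] [IsScalarTower K A A] [SMulCommClass K A A]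
    [CommSemiring R] [Algebra K R] (f : A →ₙₐ[K] R) (a : X → A)
    {φ : FreeNonUnitalNonAssocAlgebra K X} {s : Finset X}
    (hs : ∀ w ∈ φ.coeff.support, FreeMagma.letters w = s.val) :
    f (FreeNonUnitalNonAssocAlgebra.lift K a φ)
      = (φ.coeff.sum fun _ c => c) • ∏ x ∈ s, f (a x) := by
  rw [lift_eq_sum, Finsupp.sum, Finsupp.sum, map_sum, Finset.sum_smul]
  refine Finset.sum_congr rfl fun w hw => ?_
  rw [map_smul]
  congr 1
  have h := FreeMagma.map_lift_eq_prod (f : A →ₙ* R) a w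
  rw [hs w hw] at h
  exact h

namespace AlgVariety

variable {K : Type u} [Field K]

/-- A commutative associative algebra embeds into a unital one. -/
theorem exists_embedding_of_mem_CA {A : NAAlg K} (hA : (CA K).mem A) :
    ∃ (R : Type u) (_ : CommRing R) (_ : Algebra K R) (f : A →ₙₐ[K] R),
      Function.Injective f := by
  let _ : NonUnitalCommRing A :=
    { A.ring with
      mul_assoc := fun a b c => (hA.1 a b c).symm
      mul_comm := hA.2 }
  exact ⟨Unitization K A, inferInstance, inferInstance, Unitization.inrNonUnitalAlgHom K A,
    Unitization.inr_injective⟩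

/-- A multilinear identity whose coefficients add up to zero holds in all commutative associative
algebras. -/
theorem satisfiesIdentity_of_sum_eq_zero {A : NAAlg K} (hA : (CA K).mem A) {X : Type u}
    {φ : FreeNonUnitalNonAssocAlgebra K X} (hφ : IsMultilinearPoly φ)
    (h0 : (φ.coeff.sum fun _ c => c) = 0) : SatisfiesIdentity A φ := by
  intro a
  obtain ⟨s, hs⟩ := hφ
  obtain ⟨R, _, _, f, hf⟩ := exists_embedding_of_mem_CA hA
  refine hf ?_
  rw [FreeNonUnitalNonAssocAlgebra.map_lift_multilinear f a hs, h0, zero_smul, map_zero]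

/-! ### Proper operadic subvarieties as nilpotency classes -/

/-- All words of length at least `n` vanish in `A`. -/
def WordsVanish (A : NAAlg K) (n : ℕ) : Prop :=
  ∀ (X : Type u) (w : FreeMagma X) (a : X → A), n ≤ w.letters.card → FreeMagma.lift a w = 0

/-- A proper operadic subvariety of the variety of commutative associative algebras is
determined, among these, by the vanishing of all products of `n` elements, for some `n`. -/
theorem exists_nilpotency_index (V : AlgVariety K) (hV : V.IsOperadic)
    (hproper : V.IsProperSubvariety (CA K)) :
    ∃ n : ℕ, (∀ A : NAAlg K, (CA K).mem A → WordsVanish A n → V.mem A) ∧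
      ∃ (X : Type u) (s : Finset X), s.card = n ∧ 0 < n ∧
        ∀ (A : NAAlg K), V.mem A → ∀ (R : Type u) [CommRing R] [Algebra K R] (f : A →ₙₐ[K] R)
          (a : X → A), ∏ x ∈ s, f (a x) = 0 := by
  classical
  obtain ⟨X, I, hI, hmem⟩ := hV
  -- The degrees of the identities that say something new about commutative associative algebras;
  -- the index sought is the least of them.
  let P : ℕ → Prop := fun n => ∃ φ ∈ I, ∃ s : Finset X,
    (∀ w ∈ φ.coeff.support, FreeMagma.letters w = s.val) ∧
      (φ.coeff.sum fun _ c => c) ≠ 0 ∧ s.card = n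
  have hP : ∃ n, P n := by
    by_contra hno
    refine hproper.2 (AlgVariety.ext (funext fun A => propext ⟨hproper.1 A, fun hA => ?_⟩))
    rw [hmem]
    intro φ hφ
    refine satisfiesIdentity_of_sum_eq_zero hA (hI φ hφ) ?_
    by_contra h0
    obtain ⟨s, hs⟩ := hI φ hφ
    exact hno ⟨s.card, φ, hφ, s, hs, h0, rfl⟩
  refine ⟨Nat.find hP, fun A hA hw => ?_, ?_⟩
  · rw [hmem]
    intro φ hφ
    by_cases h0 : (φ.coeff.sum fun _ c => c) = 0
    · exact satisfiesIdentity_of_sum_eq_zero hA (hI φ hφ) h0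
    · intro a
      obtain ⟨s, hs⟩ := hI φ hφ
      rw [FreeNonUnitalNonAssocAlgebra.lift_eq_sum, Finsupp.sum]
      refine Finset.sum_eq_zero fun w hws => ?_
      rw [hw X w a, smul_zero]
      rw [hs w hws]
      -- Minimality: every identity with nonzero coefficient sum has degree at least the index, so
      -- all its words vanish.
      exact Nat.find_min' hP ⟨φ, hφ, s, hs, h0, rfl⟩
  · obtain ⟨φ, hφ, s, hs, h0, hcard⟩ := Nat.find_spec hP
    refine ⟨X, s, hcard, ?_, fun A hA R _ _ f a => ?_⟩
    -- A nonzero coefficient sum forces a monomial to exist, and a word has at least one letter;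
    -- this excludes index zero.
    · have hne : φ.coeff.support.Nonempty := by
        rw [Finset.nonempty_iff_ne_empty]
        intro he
        exact h0 (by rw [Finsupp.sum, he, Finset.sum_empty])
      obtain ⟨w, hw⟩ := hne
      have := w.card_letters_pos
      rw [hs w hw] at this
      rw [← hcard]
      exact this
    · rw [hmem] at hA
      have h := FreeNonUnitalNonAssocAlgebra.map_lift_multilinear f a hs
      rw [hA φ hφ a, map_zero] at h
      exact (smul_eq_zero.1 h.symm).resolve_left h0

/-! ### Ideals as sources of nilpotent algebras -/

/-- The algebra given by an ideal of a commutative unital algebra. -/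
def idealAlg {R : Type u} [CommRing R] [Algebra K R] (J : Ideal R) : NAAlg K :=
  { carrier := ({ J.restrictScalars K with
      mul_mem' := fun _ hb => J.mul_mem_left _ hb } : NonUnitalSubalgebra K R) }

/-- The inclusion of an ideal. -/
def idealAlgι {R : Type u} [CommRing R] [Algebra K R] (J : Ideal R) :
    idealAlg (K := K) J →ₙₐ[K] R :=
  NonUnitalSubalgebraClass.subtype ({ J.restrictScalars K with
      mul_mem' := fun _ hb => J.mul_mem_left _ hb } : NonUnitalSubalgebra K R)

section idealAlg

variable {R : Type u} [CommRing R] [Algebra K R] {J : Ideal R}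

theorem idealAlgι_injective : Function.Injective (idealAlgι (K := K) J) :=
  Subtype.val_injective

theorem idealAlgι_mem (a : idealAlg (K := K) J) : idealAlgι J a ∈ J := a.2

/-- An element of an ideal, as an element of the corresponding algebra. -/
def idealAlgMk (r : R) (hr : r ∈ J) : idealAlg (K := K) J := ⟨r, hr⟩

@[simp] theorem idealAlgι_mk (r : R) (hr : r ∈ J) :
    idealAlgι J (idealAlgMk (K := K) r hr) = r := rfl

theorem idealAlg_mem_CA (J : Ideal R) : (CA K).mem (idealAlg J) := by
  refine ⟨fun a b c => idealAlgι_injective ?_, fun a b => idealAlgι_injective ?_⟩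
  · simp only [map_mul, mul_assoc]
  · simp only [map_mul, mul_comm]

/-- In the ambient ring a word becomes the product of the values of its letters, which lies in the
power of `J` given by its length. -/
theorem idealAlg_wordsVanish {n : ℕ} (hJ : J ^ n = ⊥) : WordsVanish (idealAlg (K := K) J) n := by
  intro X w a hw
  refine idealAlgι_injective ?_
  have h := FreeMagma.map_lift_eq_prod (idealAlgι (K := K) J : idealAlg (K := K) J →ₙ* R) a w
  refine h.trans ?_
  rw [map_zero]
  have key : ∀ m : Multiset X, (m.map fun x => idealAlgι J (a x)).prod ∈ J ^ m.card := by
    intro m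
    induction m using Multiset.induction_on with
    | empty => simp
    | cons x m ih =>
      rw [Multiset.map_cons, Multiset.prod_cons, Multiset.card_cons, pow_succ']
      exact Ideal.mul_mem_mul (idealAlgι_mem _) ih
  have h2 := Ideal.pow_le_pow_right hw (key w.letters)
  rw [hJ] at h2
  exact h2

end idealAlg

/-! ### The small nilpotency indices -/

/-- Every variety contains the zero algebras, so only one inclusion needs the hypothesis. -/
theorem eq_triv_of_forall (V : AlgVariety K) (h : ∀ A : NAAlg K, V.mem A → ∀ a : A, a = 0) :
    V = Triv K :=
  AlgVariety.ext (funext fun A => propext ⟨h A, fun hA =>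
    V.mem_of_separated A fun a _ => hA a⟩)

theorem wordsVanish_two_of_mem_Ab {A : NAAlg K} (hA : (Ab K).mem A) : WordsVanish A 2 := by
  intro X w a hw
  cases w with
  | of x => simp [FreeMagma.letters] at hw
  | mul p q => exact (map_mul (FreeMagma.lift a) p q).trans (hA _ _)

theorem mem_CA_of_mem_Ab {A : NAAlg K} (hA : (Ab K).mem A) : (CA K).mem A :=
  ⟨fun a b c => by rw [hA, hA], fun a b => by rw [hA, hA]⟩

/-- The indices `i` and `j` depend on `s` alone, so `F` may afterwards be defined by cases on them.
This specialises the vanishing of a product of `k + 2` variables to `a ^ k * (b * c) = 0`. -/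
theorem prod_eq_pow_mul_mul {X M : Type*} [CommMonoid M] {s : Finset X} {k : ℕ}
    (hs : s.card = k + 2) : ∃ i j, i ≠ j ∧ ∀ F : X → M, ∀ b,
      (∀ x, x ≠ i → x ≠ j → F x = b) → ∏ x ∈ s, F x = b ^ k * (F i * F j) := by
  classical
  obtain ⟨i, hi, j, hj, hij⟩ := Finset.one_lt_card.1 (by omega : 1 < s.card)
  refine ⟨i, j, hij, fun F b hF => ?_⟩
  have hj' : j ∈ s.erase i := Finset.mem_erase.2 ⟨hij.symm, hj⟩
  rw [← Finset.mul_prod_erase s F hi, ← Finset.mul_prod_erase _ F hj', Finset.prod_congr rfl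
    (g := fun _ => b) fun x hx => ?_, Finset.prod_const, Finset.card_erase_of_mem hj',
    Finset.card_erase_of_mem hi, hs, ← mul_assoc, mul_comm]
  · rfl
  · simp only [Finset.mem_erase] at hx
    exact hF x hx.2.1 hx.1

/-- An operadic proper subvariety of the variety of commutative associative algebras is trivial or
abelian unless it is given by the vanishing of all products of `k + 3` elements, for some `k`. -/
theorem eq_or_exists_nilpotency_index (V : AlgVariety K) (hV : V.IsOperadic)
    (hproper : V.IsProperSubvariety (CA K)) :
    V = Ab K ∨ V = Triv K ∨
    ∃ k : ℕ, (∀ A : NAAlg K, (CA K).mem A → WordsVanish A (k + 3) → V.mem A) ∧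
      ∀ A : NAAlg K, V.mem A → ∀ (R : Type u) [CommRing R] [Algebra K R] (f : A →ₙₐ[K] R)
        (a b c : A), f a ^ (k + 1) * (f b * f c) = 0 := by
  classical
  obtain ⟨n, hn, X, s, hs, hpos, hprod⟩ := exists_nilpotency_index V hV hproper
  obtain rfl | hn1 := eq_or_ne n 1
  · refine Or.inr (Or.inl (eq_triv_of_forall V fun A hA a => ?_))
    obtain ⟨R, _, _, f, hf⟩ := exists_embedding_of_mem_CA (hproper.1 A hA)
    refine hf ?_
    have h := hprod A hA R f fun _ => a
    rwa [Finset.prod_const, hs, pow_one, ← map_zero f] at h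
  -- Index zero is excluded by `hpos`, and index one has just been treated.
  obtain ⟨k, rfl⟩ : ∃ k, n = k + 2 := ⟨n - 2, by omega⟩
  have key : ∀ A : NAAlg K, V.mem A → ∀ (R : Type u) [CommRing R] [Algebra K R] (f : A →ₙₐ[K] R)
        (a b c : A), f a ^ k * (f b * f c) = 0 := by
    intro A hA R _ _ f a b c
    obtain ⟨i, j, hij, hF⟩ := prod_eq_pow_mul_mul (M := R) hs
    have h1 := hF (fun x => f (if x = i then b else if x = j then c else a)) (f a) fun x hi hj => by
      rw [if_neg hi, if_neg hj]
    rw [hprod A hA R f, if_pos rfl, if_neg hij.symm, if_pos rfl] at h1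
    exact h1.symm
  cases k with
  | zero =>
    refine Or.inl (AlgVariety.ext (funext fun A => propext ⟨fun hA a b => ?_, fun hA => ?_⟩))
    · obtain ⟨R, _, _, f, hf⟩ := exists_embedding_of_mem_CA (hproper.1 A hA)
      refine hf ?_
      rw [map_mul, map_zero, ← key A hA R f a a b, pow_zero, one_mul]
    · exact hn A (mem_CA_of_mem_Ab hA) (wordsVanish_two_of_mem_Ab hA)
  | succ k => exact Or.inr (Or.inr ⟨k, hn, key⟩)

/-! ### The line with zero multiplication represents elements of square zero -/

variable (K) in
/-- The one-dimensional algebra with zero multiplication. -/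
noncomputable abbrev sqZeroAlg : NAAlg K :=
  idealAlg (RingHom.ker (TrivSqZeroExt.fstHom K K K))

theorem sqZeroAlg_mem_Ab : (Ab K).mem (sqZeroAlg K) := by
  intro a b
  refine idealAlgι_injective ?_
  have ha : (idealAlgι _ a).fst = 0 := idealAlgι_mem a
  have hb : (idealAlgι _ b).fst = 0 := idealAlgι_mem b
  rw [map_mul, map_zero]
  ext <;> simp [ha, hb]

/-- The generator of the one-dimensional algebra with zero multiplication. -/
noncomputable def sqZeroGen : sqZeroAlg K :=
  idealAlgMk (J := RingHom.ker (TrivSqZeroExt.fstHom K K K)) (TrivSqZeroExt.inr 1) (by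
    simp [RingHom.mem_ker])

/-- The homomorphism given by an element with zero square. -/
noncomputable def sqZeroHom {A : NAAlg K} (a : A) (ha : a * a = 0) : sqZeroAlg K →ₙₐ[K] A where
  toFun b := (idealAlgι (RingHom.ker (TrivSqZeroExt.fstHom K K K)) b).snd • a
  map_smul' c b := by
    simp only [map_smul, TrivSqZeroExt.snd_smul, smul_assoc]
    rfl
  map_zero' := by simp only [map_zero, TrivSqZeroExt.snd_zero, zero_smul]
  map_add' b c := by simp only [map_add, TrivSqZeroExt.snd_add, add_smul]
  map_mul' b c := by
    rw [sqZeroAlg_mem_Ab b c, map_zero, TrivSqZeroExt.snd_zero, zero_smul, smul_mul_smul_comm,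
      ha, smul_zero]

@[simp] theorem sqZeroHom_gen {A : NAAlg K} (a : A) (ha : a * a = 0) :
    sqZeroHom a ha sqZeroGen = a := by
  change (TrivSqZeroExt.snd (idealAlgι (RingHom.ker (TrivSqZeroExt.fstHom K K K)) sqZeroGen)) • a
    = a
  rw [sqZeroGen, idealAlgι_mk, TrivSqZeroExt.snd_inr, one_smul]

/-- The algebra is spanned by its generator. -/
theorem sqZeroAlg_hom_ext {A : NAAlg K} {f g : sqZeroAlg K →ₙₐ[K] A}
    (h : f sqZeroGen = g sqZeroGen) : f = g := by
  ext b
  have hb : b = (idealAlgι (RingHom.ker (TrivSqZeroExt.fstHom K K K)) b).snd • sqZeroGen := by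
    refine idealAlgι_injective ?_
    have h0 : (idealAlgι (RingHom.ker (TrivSqZeroExt.fstHom K K K)) b).fst = 0 := idealAlgι_mem b
    rw [map_smul, sqZeroGen, idealAlgι_mk]
    ext <;> simp [h0]
  rw [hb, map_smul, map_smul, h]

/-! ### The test algebras and their nilpotency -/

theorem idealAlg_wordsVanish_three {R : Type u} [CommRing R] [Algebra K R] {J : Ideal R}
    (h : ∀ a ∈ J, ∀ b ∈ J, ∀ c ∈ J, a * b * c = 0) : WordsVanish (idealAlg (K := K) J) 3 := by
  refine idealAlg_wordsVanish ?_
  rw [pow_succ, pow_two, eq_bot_iff, Ideal.mul_le]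
  intro r hr c hc
  rw [Ideal.mem_bot]
  induction hr using Submodule.mul_induction_on' with
  | mem_mul_mem a ha b hb => exact h a ha b hb c hc
  | add x _ y _ hx hy => rw [add_mul, hx, hy, add_zero]

/-- In the binomial expansion, a term with fewer than `m` factors `(x)` has at least two factors
`(e)`. -/
theorem _root_.Ideal.span_sup_span_pow_eq_bot {R : Type*} [CommRing R] {x e : R} {m : ℕ}
    (hx : x ^ m = 0) (he : e ^ 2 = 0) : (Ideal.span {x} ⊔ Ideal.span {e}) ^ (m + 1) = ⊥ := by
  rw [← Ideal.add_eq_sup, add_pow]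
  have h1 : Ideal.span {x} ^ m = 0 := by
    rw [Ideal.span_singleton_pow, hx]
    simp
  have h2 : Ideal.span {e} ^ 2 = 0 := by
    rw [Ideal.span_singleton_pow, he]
    simp
  refine Finset.sum_eq_zero fun i _ => ?_
  obtain hi | hi := le_or_gt m i
  · rw [pow_eq_zero_of_le hi h1, zero_mul, zero_mul]
  · rw [pow_eq_zero_of_le (by omega) h2, mul_zero, zero_mul]

variable (K) in
/-- The algebra `K[y, z]/(y ^ 2, z ^ 2)`. -/
def Bidual : Type u := DualNumber (DualNumber K)

noncomputable instance : CommRing (Bidual K) :=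
  inferInstanceAs (CommRing (DualNumber (DualNumber K)))

noncomputable instance : Algebra K (Bidual K) :=
  inferInstanceAs (Algebra K (DualNumber (DualNumber K)))

namespace Bidual

/-- The part of an element that does not involve `z`. -/
noncomputable def fst : Bidual K →ₐ[K] DualNumber K :=
  TrivSqZeroExt.fstHom K (DualNumber K) (DualNumber K)

/-- The coefficient of `z`. -/
noncomputable def snd : Bidual K →ₗ[K] DualNumber K :=
  TrivSqZeroExt.sndHom (DualNumber K) (DualNumber K) |>.restrictScalars K

variable (K) in
/-- The generator `y`. -/
noncomputable def genFst : Bidual K := TrivSqZeroExt.inl DualNumber.eps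

variable (K) in
/-- The generator `z`. -/
noncomputable def genSnd : Bidual K := TrivSqZeroExt.inr 1

theorem ext' {r s : Bidual K} (h : fst r = fst s) (h' : snd r = snd s) : r = s :=
  TrivSqZeroExt.ext h h'

@[simp] theorem snd_mul (r s : Bidual K) : snd (r * s) = fst r * snd s + snd r * fst s := rfl

@[simp] theorem fst_genFst : fst (genFst K) = DualNumber.eps := rfl
@[simp] theorem snd_genFst : snd (genFst K) = 0 := rfl
@[simp] theorem fst_genSnd : fst (genSnd K) = 0 := rfl
@[simp] theorem snd_genSnd : snd (genSnd K) = 1 := rfl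

variable (K) in
/-- The augmentation ideal. -/
noncomputable def ideal : Ideal (Bidual K) := (RingHom.ker (TrivSqZeroExt.fstHom K K K)).comap fst

theorem mem_ideal {r : Bidual K} : r ∈ ideal K ↔ (fst r).fst = 0 := Iff.rfl

/-- A product of three elements without constant term involves `y ^ 2` or `z ^ 2` in each monomial.
Hence this algebra lies in every variety with nilpotency index at least three. -/
theorem wordsVanish_ideal : WordsVanish (idealAlg (K := K) (ideal K)) 3 := by
  refine idealAlg_wordsVanish_three fun a ha b hb c hc => ?_
  rw [mem_ideal] at ha hb hc
  refine ext' ?_ ?_ <;> ext <;> simp [ha, hb, hc]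

/-- The projection of the augmentation ideal to the span of `y`. -/
noncomputable def proj : idealAlg (K := K) (ideal K) →ₙₐ[K] sqZeroAlg K where
  toFun a := idealAlgMk (fst (idealAlgι (ideal K) a)) (idealAlgι_mem a)
  map_smul' c a := idealAlgι_injective (by simp only [map_smul]; rfl)
  map_zero' := idealAlgι_injective (by simp)
  map_add' a b := idealAlgι_injective (by simp only [map_add]; rfl)
  map_mul' a b := idealAlgι_injective (by simp only [map_mul]; rfl)

theorem fst_eq_zero_of_proj {a : idealAlg (K := K) (ideal K)} (h : proj a = 0) :
    fst (idealAlgι (ideal K) a) = 0 := by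
  have := congrArg (idealAlgι _) h
  rwa [map_zero] at this

end Bidual

section Truncated

open Polynomial

variable (K) in
/-- The algebra `K[x, e]/(x ^ (m + 1), e ^ 2)`, with its generators. -/
theorem exists_truncated (m : ℕ) : ∃ (R : Type u) (_ : CommRing R) (_ : Algebra K R) (x e : R),
    x ^ (m + 1) = 0 ∧ e ^ 2 = 0 ∧ x ^ m * e ≠ 0 := by
  have hx : AdjoinRoot.root (X ^ (m + 1) : K[X]) ^ (m + 1) = 0 := by
    rw [← AdjoinRoot.mk_X, ← map_pow, AdjoinRoot.mk_self]
  have hx' : AdjoinRoot.root (X ^ (m + 1) : K[X]) ^ m ≠ 0 := by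
    rw [← AdjoinRoot.mk_X, ← map_pow, Ne, AdjoinRoot.mk_eq_zero]
    intro h
    have := (pow_dvd_pow_iff (X_ne_zero (R := K)) Polynomial.not_isUnit_X).1 h
    omega
  refine ⟨DualNumber (AdjoinRoot (X ^ (m + 1) : K[X])), inferInstance, inferInstance,
    TrivSqZeroExt.inlHom _ _ (AdjoinRoot.root (X ^ (m + 1) : K[X])), DualNumber.eps,
    ?_, DualNumber.eps_pow_two, ?_⟩
  · rw [← map_pow, hx, map_zero]
  · rw [← map_pow]
    intro h
    apply hx'
    have h2 := congrArg TrivSqZeroExt.snd h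
    simpa using h2

end Truncated

theorem WordsVanish.mono {A : NAAlg K} {m n : ℕ} (h : WordsVanish A m) (hmn : m ≤ n) :
    WordsVanish A n :=
  fun X w a hw => h X w a (hmn.trans hw)

/-! ### Elements of square zero in cosmash products -/

section CosmashElements

variable {V : AlgVariety K}

theorem toHom_comp_apply {A B C : V.Cat} (f : A ⟶ B) (g : B ⟶ C) (a : A.obj) :
    toHom (f ≫ g) a = toHom g (toHom f a) := rfl

theorem toHom_inl_desc {A B C : V.Cat} (f : A ⟶ C) (g : B ⟶ C) (a : A.obj) :
    toHom (coprod.desc f g) (toHom coprod.inl a) = toHom f a := by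
  rw [← toHom_comp_apply, coprod.inl_desc]

theorem toHom_inr_desc {A B C : V.Cat} (f : A ⟶ C) (g : B ⟶ C) (b : B.obj) :
    toHom (coprod.desc f g) (toHom coprod.inr b) = toHom g b := by
  rw [← toHom_comp_apply, coprod.inr_desc]

/-- One factor of square zero suffices for a product to be represented by a morphism from `sqZeroAlg
K`. -/
theorem mul_mul_self_eq_zero {A : NAAlg K} (hA : (CA K).mem A) (a : A) {b : A} (hb : b * b = 0) :
    (a * b) * (a * b) = 0 := by
  rw [← hA.1 a b, hA.2 b, ← hA.1 a b b, hb, mul_zero, mul_zero]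

theorem toHom_cosmashTwoι_desc {A B C : V.Cat} (f : A ⟶ C) (t : (cosmashTwo A B).obj) :
    toHom (coprod.desc f (0 : B ⟶ C)) (toHom (cosmashTwoι A B) t) = 0 := by
  rw [← toHom_comp_apply, cosmashTwoι_comp_left, toHom_zero]
  rfl

/-- Elements of square zero are morphisms from the one-dimensional abelian algebra. -/
theorem eq_zero_of_mono (hF : V.mem (sqZeroAlg K)) {A B : V.Cat} (f : A ⟶ B) [Mono f] {a : A.obj}
    (ha : a * a = 0) (h : toHom f a = 0) : a = 0 := by
  let F : V.Cat := ⟨sqZeroAlg K, hF⟩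
  let α : F ⟶ A := ofHom (sqZeroHom a ha)
  have hα : toHom α sqZeroGen = a := sqZeroHom_gen a ha
  have h0 : α ≫ f = 0 := congrArg ofHom (sqZeroAlg_hom_ext (f := toHom (α ≫ f)) (g := 0) (by
    rw [toHom_comp_apply, hα, h]
    rfl))
  rw [zero_of_comp_mono f h0] at hα
  exact hα.symm

/-- An element of square zero in `A + B` that vanishes in `A` and in `B` comes from `A ⋄ B`. -/
theorem exists_cosmashTwo (hF : V.mem (sqZeroAlg K)) {A B : V.Cat} {a : (A ⨿ B : V.Cat).obj}
    (ha : a * a = 0) (h1 : toHom (coprod.desc (𝟙 A) (0 : B ⟶ A)) a = 0)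
    (h2 : toHom (coprod.desc (0 : A ⟶ B) (𝟙 B)) a = 0) :
    ∃ t : (cosmashTwo A B).obj, toHom (cosmashTwoι A B) t = a ∧ t * t = 0 := by
  let F : V.Cat := ⟨sqZeroAlg K, hF⟩
  let α : F ⟶ A ⨿ B := ofHom (sqZeroHom a ha)
  have hα : toHom α sqZeroGen = a := sqZeroHom_gen a ha
  have hz : ∀ {C : V.Cat} (f : A ⨿ B ⟶ C), toHom f a = 0 → α ≫ f = 0 := fun f hf =>
    congrArg ofHom (sqZeroAlg_hom_ext (f := toHom (α ≫ f)) (g := 0) (by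
      rw [toHom_comp_apply, hα, hf]
      rfl))
  have h0 : α ≫ sigmaTwo A B = 0 := by
    rw [sigmaTwo, prod.comp_lift, hz _ h1, hz _ h2]
    ext <;> simp [prod.lift_fst, prod.lift_snd]
  refine ⟨toHom (kernel.lift _ α h0) sqZeroGen, ?_, ?_⟩
  · rw [← toHom_comp_apply, cosmashTwoι, kernel.lift_ι, hα]
  · rw [← map_mul, sqZeroAlg_mem_Ab, map_zero]

/-- The product of an element of `A` with an element of `B` of square zero comes from `A ⋄ B`. -/
theorem exists_cosmashTwo_mul (hF : V.mem (sqZeroAlg K))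
    (hV : ∀ A : NAAlg K, V.mem A → (CA K).mem A)
    {A B : V.Cat} (a : A.obj) {b : B.obj} (hb : b * b = 0) :
    ∃ t : (cosmashTwo A B).obj, toHom (cosmashTwoι A B) t
      = toHom coprod.inl a * toHom coprod.inr b ∧ t * t = 0 := by
  refine exists_cosmashTwo hF (mul_mul_self_eq_zero (hV _ (A ⨿ B).property) _ ?_) ?_ ?_
  · rw [← map_mul, hb, map_zero]
  · rw [map_mul, toHom_inr_desc, toHom_zero]
    exact mul_zero _
  · rw [map_mul, toHom_inl_desc, toHom_zero]
    exact zero_mul _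

/-- If `x(yz)` vanishes in `X + Y + Z`, where `y` and `z` have square zero, then it vanishes
in `X + (Y ⋄ Z)`. -/
theorem mul_eq_zero_of_cosmashAssociative (hF : V.mem (sqZeroAlg K))
    (hV : ∀ A : NAAlg K, V.mem A → (CA K).mem A) (hassoc : CosmashAssociative V.Cat)
    {X Y Z : V.Cat} (x : X.obj) {y : Y.obj} {z : Z.obj} {t : (cosmashTwo Y Z).obj}
    (ht : toHom (cosmashTwoι Y Z) t = toHom coprod.inl y * toHom coprod.inr z)
    (ht2 : t * t = 0)
    (h : toHom (coprod.inl : X ⟶ X ⨿ (Y ⨿ Z)) x * (toHom (coprod.inr : Y ⨿ Z ⟶ X ⨿ (Y ⨿ Z))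
      (toHom coprod.inl y) * toHom (coprod.inr : Y ⨿ Z ⟶ X ⨿ (Y ⨿ Z)) (toHom coprod.inr z)) = 0) :
    toHom (coprod.inl : X ⟶ X ⨿ cosmashTwo Y Z) x * toHom coprod.inr t = 0 := by
  -- The element `u` of `X ⋄ (Y ⋄ Z)` lies over `x * t`, and the comparison morphism carries it over
  -- `x * (y * z)`. Injectivity on elements of square zero, for the kernel inclusion and then for
  -- the comparison, gives `u = 0`.
  obtain ⟨u, hu, hu2⟩ := exists_cosmashTwo_mul hF hV x ht2
  have := (hassoc X Y Z).1
  have hc2 : toHom (comparisonRight X Y Z) u * toHom (comparisonRight X Y Z) u = 0 := by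
    rw [← map_mul, hu2, map_zero]
  have hc : toHom (comparisonRight X Y Z) u = 0 := by
    refine eq_zero_of_mono hF (kernel.ι (sigmaThree X Y Z)) hc2 ?_
    rw [← toHom_comp_apply, comparisonRight, kernel.lift_ι, toHom_comp_apply, hu, map_mul,
      ← toHom_comp_apply, ← toHom_comp_apply, coprod.inl_map, coprod.inr_map, Category.id_comp,
      toHom_comp_apply, ht, map_mul, h]
  rw [← hu, eq_zero_of_mono hF _ hu2 hc, map_zero]

/-- The coefficient of `yz`, as a homomorphism from `Y ⋄ Z` to any algebra with an element of
square zero, where `Y` and `Z` are spanned by `y` and `z`. -/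
theorem exists_hom_cosmashTwo (hF : V.mem (sqZeroAlg K))
    (hB : V.mem (idealAlg (K := K) (Bidual.ideal K)))
    {A : V.Cat} {e : A.obj} (he : e * e = 0) :
    let F : V.Cat := ⟨sqZeroAlg K, hF⟩
    ∃ g : cosmashTwo F F ⟶ A, ∀ t : (cosmashTwo F F).obj, toHom (cosmashTwoι F F) t
      = toHom coprod.inl sqZeroGen * toHom coprod.inr sqZeroGen → toHom g t = e := by
  intro F
  let B : V.Cat := ⟨_, hB⟩
  let y : B.obj := idealAlgMk (Bidual.genFst K) (Bidual.mem_ideal.2 rfl)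
  let z : B.obj := idealAlgMk (Bidual.genSnd K) (Bidual.mem_ideal.2 rfl)
  have hyy : y * y = 0 := idealAlgι_injective (by
    rw [map_mul, map_zero]
    refine Bidual.ext' ?_ ?_ <;> simp [y])
  have hzz : z * z = 0 := idealAlgι_injective (by
    rw [map_mul, map_zero]
    refine Bidual.ext' ?_ ?_ <;> simp [z])
  let q : F ⨿ F ⟶ B := coprod.desc (ofHom (sqZeroHom y hyy)) (ofHom (sqZeroHom z hzz))
  -- Setting `z` to zero in `B` corresponds under `q` to the first component of `sigmaTwo F F`,
  -- which kills `F ⋄ F`.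
  have hq1 : q ≫ ofHom (B := F) Bidual.proj = coprod.desc (𝟙 F) 0 := by
    apply coprod.hom_ext
    · rw [coprod.inl_desc, coprod.inl_desc_assoc]
      refine congrArg ofHom (sqZeroAlg_hom_ext ?_)
      change Bidual.proj (sqZeroHom y hyy sqZeroGen) = sqZeroGen
      rw [sqZeroHom_gen]
      rfl
    · rw [coprod.inr_desc, coprod.inr_desc_assoc]
      refine congrArg ofHom (sqZeroAlg_hom_ext ?_)
      change Bidual.proj (sqZeroHom z hzz sqZeroGen) = 0
      rw [sqZeroHom_gen]
      rfl
  let r : cosmashTwo F F ⟶ B := cosmashTwoι F F ≫ q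
  -- The image of `F ⋄ F` therefore consists of multiples of `z`, and any two of these have product
  -- zero. With `he`, this makes the linear map `g` below multiplicative: both sides vanish.
  have hr : ∀ t, Bidual.fst (idealAlgι (Bidual.ideal K) (toHom r t)) = 0 := by
    intro t
    apply Bidual.fst_eq_zero_of_proj
    have h := toHom_cosmashTwoι_desc (𝟙 F) t
    rw [← hq1] at h
    exact h
  let l : Bidual K →ₗ[K] K := (TrivSqZeroExt.sndHom K K).comp Bidual.snd
  let g : (cosmashTwo F F).obj →ₙₐ[K] A.obj :=
    { toFun := fun t => l (idealAlgι (Bidual.ideal K) (toHom r t)) • e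
      map_smul' := fun c t => by
        simp only [map_smul, smul_assoc]
        rfl
      map_zero' := by simp only [map_zero, zero_smul]
      map_add' := fun s t => by simp only [map_add, add_smul]
      map_mul' := fun s t => by
        have h0 : l (idealAlgι (Bidual.ideal K) (toHom r s) *
            idealAlgι (Bidual.ideal K) (toHom r t)) = 0 := by
          simp [l, hr]
        rw [map_mul, map_mul, h0, zero_smul, smul_mul_smul_comm, he, smul_zero] }
  refine ⟨ofHom g, fun t ht => ?_⟩
  have hrt : toHom r t = y * z := by
    change toHom q (toHom (cosmashTwoι F F) t) = _
    rw [ht, map_mul, toHom_inl_desc, toHom_inr_desc, toHom_ofHom, toHom_ofHom]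
    exact congrArg₂ _ (sqZeroHom_gen y hyy) (sqZeroHom_gen z hzz)
  change l (idealAlgι (Bidual.ideal K) (toHom r t)) • e = e
  have h1 : l (idealAlgι (Bidual.ideal K) (y * z)) = 1 := by
    rw [map_mul]
    simp [l, y, z]
  rw [hrt, h1, one_smul]

end CosmashElements

/-! ### Failure of cosmash associativity -/

/-- The witness is the left-bracketed power. A single `b` must serve all `f`: it is evaluated both
in the ring containing `A` as an ideal and in a ring containing a coproduct. -/
theorem exists_map_eq_pow {A : NAAlg K} (a : A) (k : ℕ) :
    ∃ b : A, ∀ (R : Type u) [CommRing R] [Algebra K R] (f : A →ₙₐ[K] R), f b = f a ^ (k + 1) := by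
  induction k with
  | zero => exact ⟨a, fun R _ _ f => by rw [zero_add, pow_one]⟩
  | succ k ih =>
    obtain ⟨b, hb⟩ := ih
    exact ⟨b * a, fun R _ _ f => by rw [map_mul, hb, ← pow_succ]⟩

/-- The variety of commutative associative algebras with vanishing products of `k + 3` elements is
not cosmash associative. -/
theorem not_cosmashAssociative_of_nilpotency_index {V : AlgVariety K}
    (hV : ∀ A : NAAlg K, V.mem A → (CA K).mem A) {k : ℕ}
    (hmem : ∀ A : NAAlg K, (CA K).mem A → WordsVanish A (k + 3) → V.mem A)
    (hnil : ∀ A : NAAlg K, V.mem A → ∀ (R : Type u) [CommRing R] [Algebra K R] (f : A →ₙₐ[K] R)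
        (a b c : A), f a ^ (k + 1) * (f b * f c) = 0) :
    ¬ CosmashAssociative V.Cat := by
  intro hassoc
  have hF : V.mem (sqZeroAlg K) := hmem _ (mem_CA_of_mem_Ab sqZeroAlg_mem_Ab)
    ((wordsVanish_two_of_mem_Ab sqZeroAlg_mem_Ab).mono (by omega))
  have hB : V.mem (idealAlg (K := K) (Bidual.ideal K)) := hmem _ (idealAlg_mem_CA _)
    (Bidual.wordsVanish_ideal.mono (by omega))
  -- With this exponent `x ^ (k + 2) = 0`, so products of `k + 3` elements of `(x, e)` vanish and
  -- the ideal lies in `V`, while the product `x ^ (k + 1) * e` of only `k + 2` elements survives.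
  obtain ⟨R, _, _, x, e, hx, he, hxe⟩ := exists_truncated K (k + 1)
  let J : Ideal R := Ideal.span {x} ⊔ Ideal.span {e}
  let A : V.Cat := ⟨idealAlg J, hmem _ (idealAlg_mem_CA _)
    (idealAlg_wordsVanish (Ideal.span_sup_span_pow_eq_bot hx he))⟩
  let xA : A.obj := idealAlgMk x (Ideal.mem_sup_left (Ideal.mem_span_singleton_self x))
  let eA : A.obj := idealAlgMk e (Ideal.mem_sup_right (Ideal.mem_span_singleton_self e))
  have heA : eA * eA = 0 := idealAlgι_injective (by
    rw [map_mul, map_zero, ← pow_two]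
    exact he)
  obtain ⟨w, hw⟩ := exists_map_eq_pow xA k
  let F : V.Cat := ⟨sqZeroAlg K, hF⟩
  obtain ⟨t, ht, ht2⟩ := exists_cosmashTwo_mul hF hV (A := F) (B := F) sqZeroGen
    (sqZeroAlg_mem_Ab (K := K) sqZeroGen sqZeroGen)
  obtain ⟨g, hg⟩ := exists_hom_cosmashTwo hF hB heA
  -- In `A + (F + F)` the element `w * (y * z)`, with `w` the power `x ^ (k + 1)`, has `k + 3`
  -- factors and is killed by `hnil`.
  have h := mul_eq_zero_of_cosmashAssociative hF hV hassoc w ht ht2 (by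
    obtain ⟨S, _, _, f, hf⟩ := exists_embedding_of_mem_CA (hV _ (A ⨿ (F ⨿ F)).property)
    refine hf ?_
    rw [map_mul, map_mul, map_zero]
    have hwS := hw S (f.comp (toHom (coprod.inl : A ⟶ A ⨿ (F ⨿ F))))
    rw [NonUnitalAlgHom.comp_apply, NonUnitalAlgHom.comp_apply] at hwS
    rw [hwS]
    exact hnil _ (A ⨿ (F ⨿ F)).property S f _ _ _)
  -- Mapping `A + (F ⋄ F)` to `A` by the identity and `g` turns `w * t = 0` into `x ^ (k + 1) * e =
  -- 0`.
  have h2 := congrArg (toHom (coprod.desc (𝟙 A) g)) h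
  rw [map_mul, toHom_inl_desc, toHom_inr_desc, hg t ht, map_zero] at h2
  have h3 : idealAlgι J w * e = 0 := (map_mul (idealAlgι J) w eA).symm.trans
    ((congrArg (idealAlgι J) h2).trans (map_zero _))
  exact hxe (by rw [← h3, hw R (idealAlgι J)]; rfl)

end AlgVariety

/-- A cosmash associative operadic variety of `K`-algebras that is a proper subvariety of the
variety of commutative associative algebras is either the variety of abelian algebras or the variety
of trivial algebras. -/
theorem proposition9p1 {K : Type u} [Field K] (V : AlgVariety K) (hV : V.IsOperadic)
    (hassoc : CosmashAssociative V.Cat) (hproper : V.IsProperSubvariety (AlgVariety.CA K)) :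
    V = AlgVariety.Ab K ∨ V = AlgVariety.Triv K := by
  obtain h | h | ⟨k, hmem, hnil⟩ := V.eq_or_exists_nilpotency_index hV hproper
  · exact Or.inl h
  · exact Or.inr h
  · exact absurd hassoc (AlgVariety.not_cosmashAssociative_of_nilpotency_index hproper.1 hmem hnil)
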